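/- Fix an integer $n \ge 1$. For each integer $k \ge 1$ let $Y_1^{(k)}, Y_2^{(k)} \in \mathcal{M}_k(\mathbb{C})$ be orthogonal projections of rank one, and let $U = U^{(k)}$ be a random unitary matrix distributed according to the normalized Haar measure on the unitary group $\mathcal{U}(nk)$ of $\mathbb{C}^n \otimes \mathbb{C}^k$. Let $\overline U$ denote the entrywise complex conjugate of $U$, and define $$\Phi^{U}(X) = \mathrm{Tr}_{\mathbb{C}^k}\big[U (X \otimes Y_1^{(k)}) U^*\big], \qquad \Phi^{\overline U}(X) = \mathrm{Tr}_{\mathbb{C}^k}\big[\overline U (X \otimes Y_2^{(k)}) \overline U^{\,*}\big], \qquad X \in \mathcal{M}_n(\mathbb{C}),$$ where $\mathrm{Tr}_{\mathbb{C}^k}$ is the non-normalized partial trace over the second factor. Let $$E_n = \frac1n \sum_{i,j=1}^n |e_i\rangle\langle e_j| \otimes |e_i\rangle\langle e_j|$$ be the maximally entangled Bell state, and put $Z = Z^{(k)} = [\Phi^{U} \otimes \Phi^{\overline U}](E_n) \in \mathcal{M}_{n^2}(\mathbb{C})$. Then, with $n$ fixed and $k \to \infty$: 1. for every integer $p \ge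 1$ the random variable $\mathrm{Tr}(Z^p)$ (non-normalized trace) is integrable and $$\lim_{k \to \infty} \mathbb{E}\big[\mathrm{Tr}(Z^p)\big] = n^{2-2p};$$ 2. $Z$ converges in probability to the chaotic state $\rho_* = \mathrm{I}_{n^2}/n^2$: for every $\varepsilon > 0$, $$\lim_{k \to \infty} \mathbb{P}\big(\|Z - \rho_*\|_{HS} \ge \varepsilon\big) = 0,$$ where $\|\cdot\|_{HS}$ is the Hilbert–Schmidt norm. -/

import Mathlib

open MeasureTheory Filter Topology
open scoped Matrix Kronecker

namespace RandomChannel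

noncomputable section

/-- The Borel σ-algebra of the unitary group (with its topology as a set of matrices). -/
instance unitaryMeasurableSpace {ι : Type*} [Fintype ι] [DecidableEq ι] :
    MeasurableSpace (Matrix.unitaryGroup ι ℂ) := borel _

instance unitaryBorelSpace {ι : Type*} [Fintype ι] [DecidableEq ι] :
    BorelSpace (Matrix.unitaryGroup ι ℂ) := ⟨rfl⟩

instance unitaryCompactSpace {ι : Type*} [Fintype ι] [DecidableEq ι] :
    CompactSpace (Matrix.unitaryGroup ι ℂ) := by
  refine (isCompact_iff_compactSpace
    (s := ((Matrix.unitaryGroup ι ℂ : Submonoid (Matrix ι ι ℂ)) : Set (Matrix ι ι ℂ)))).mp ?_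
  have hK : IsCompact (Set.univ.pi fun _ : ι => Set.univ.pi fun _ : ι =>
      Metric.closedBall (0 : ℂ) 1) :=
    isCompact_univ_pi fun _ => isCompact_univ_pi fun _ => isCompact_closedBall _ _
  refine hK.of_isClosed_subset ?_ ?_
  · have hset : ((Matrix.unitaryGroup ι ℂ : Submonoid (Matrix ι ι ℂ)) : Set (Matrix ι ι ℂ))
        = {A : Matrix ι ι ℂ | A * star A = 1} := by
      ext A
      exact Matrix.mem_unitaryGroup_iff
    rw [hset]
    exact isClosed_eq (by fun_prop) continuous_const
  · intro A hA i _ j _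
    simpa using entry_norm_bound_of_unitary (𝕜 := ℂ) hA i j

/-- The Haar measure on the unitary group, normalized to total mass `1`. -/
def haarUnitary (ι : Type*) [Fintype ι] [DecidableEq ι] :
    Measure (Matrix.unitaryGroup ι ℂ) :=
  Measure.haarMeasure ⊤

/-- The (non-normalized) partial trace over the second tensor factor. -/
def partialTrace {n k : ℕ} (M : Matrix (Fin n × Fin k) (Fin n × Fin k) ℂ) :
    Matrix (Fin n) (Fin n) ℂ :=
  Matrix.of fun i j => ∑ a : Fin k, M (i, a) (j, a)

/-- The map `X ↦ Tr_K [W (X ⊗ Y) W*]`; for `W` unitary and `Y` a density matrix this is the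
quantum channel with Stinespring data `(W, Y)`. -/
def channel {n k : ℕ} (W : Matrix (Fin n × Fin k) (Fin n × Fin k) ℂ)
    (Y : Matrix (Fin k) (Fin k) ℂ) :
    Matrix (Fin n) (Fin n) ℂ →ₗ[ℂ] Matrix (Fin n) (Fin n) ℂ where
  toFun X := partialTrace (W * (X ⊗ₖ Y) * Wᴴ)
  map_add' X X' := by
    ext i j
    simp [partialTrace, Matrix.add_kronecker, mul_add, add_mul, Finset.sum_add_distrib]
  map_smul' c X := by
    ext i j
    simp [partialTrace, Matrix.smul_kronecker, Finset.mul_sum]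

/-- The tensor product `Φ ⊗ Ψ` of two linear maps on matrices, acting on matrices over the
product index set: the linear map with `(Φ ⊗ Ψ) (A ⊗ B) = Φ A ⊗ Ψ B`
(see `tensorMap_kronecker`). -/
def tensorMap {n : ℕ} (Φ Ψ : Matrix (Fin n) (Fin n) ℂ →ₗ[ℂ] Matrix (Fin n) (Fin n) ℂ)
    (X : Matrix (Fin n × Fin n) (Fin n × Fin n) ℂ) :
    Matrix (Fin n × Fin n) (Fin n × Fin n) ℂ :=
  ∑ a : Fin n × Fin n, ∑ b : Fin n × Fin n,
    X a b • (Φ (Matrix.single a.1 b.1 1) ⊗ₖ Ψ (Matrix.single a.2 b.2 1))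

theorem tensorMap_kronecker {n : ℕ}
    (Φ Ψ : Matrix (Fin n) (Fin n) ℂ →ₗ[ℂ] Matrix (Fin n) (Fin n) ℂ)
    (A B : Matrix (Fin n) (Fin n) ℂ) :
    tensorMap Φ Ψ (A ⊗ₖ B) = Φ A ⊗ₖ Ψ B := by
  have key : ∀ (Θ : Matrix (Fin n) (Fin n) ℂ →ₗ[ℂ] Matrix (Fin n) (Fin n) ℂ)
      (C : Matrix (Fin n) (Fin n) ℂ) (i j : Fin n),
      Θ C i j = ∑ a, ∑ b, C a b * Θ (Matrix.single a b 1) i j := by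
    intro Θ C i j
    conv_lhs => rw [Matrix.matrix_eq_sum_single C]
    simp only [map_sum, Matrix.sum_apply]
    refine Finset.sum_congr rfl fun a _ => Finset.sum_congr rfl fun b _ => ?_
    have h : Matrix.single a b (C a b) = C a b • Matrix.single a b (1 : ℂ) := by
      simp [Matrix.smul_single]
    rw [h, map_smul, Matrix.smul_apply, smul_eq_mul]
  ext i j
  rw [Matrix.kronecker_apply, key Φ A, key Ψ B, Finset.sum_mul_sum]
  simp only [tensorMap, Matrix.sum_apply, Matrix.smul_apply, Matrix.kronecker_apply,
    smul_eq_mul, Fintype.sum_prod_type]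
  refine Finset.sum_congr rfl fun a _ => Finset.sum_congr rfl fun b _ => ?_
  rw [Finset.sum_mul_sum]
  refine Finset.sum_congr rfl fun c _ => Finset.sum_congr rfl fun d _ => ?_
  rw [Matrix.kronecker_apply]
  ring

/-- The (normalized) maximally entangled Bell state
`E_n = (1/n) ∑ i j, |e_i⟩⟨e_j| ⊗ |e_i⟩⟨e_j|`. -/
def bellState (n : ℕ) : Matrix (Fin n × Fin n) (Fin n × Fin n) ℂ :=
  (1 / (n : ℂ)) • ∑ i : Fin n, ∑ j : Fin n,
    (Matrix.single i j (1 : ℂ)) ⊗ₖ (Matrix.single i j (1 : ℂ))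

/-- The chaotic state `I / n²`. -/
def chaoticState (n : ℕ) : Matrix (Fin n × Fin n) (Fin n × Fin n) ℂ :=
  (1 / (n : ℂ) ^ 2) • 1

/-- Orthogonal projections of rank one. -/
def IsRankOneProjector {k : ℕ} (Y : Matrix (Fin k) (Fin k) ℂ) : Prop :=
  IsStarProjection Y ∧ Y.rank = 1

/-- `Z = [Φ^{U,Y₁} ⊗ Φ^{Ū,Y₂}] (E_n)`, where `Ū` is the entrywise complex conjugate of `U`. -/
def conjugateOutput {n k : ℕ} (Y₁ Y₂ : Matrix (Fin k) (Fin k) ℂ)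
    (U : Matrix.unitaryGroup (Fin n × Fin k) ℂ) :
    Matrix (Fin n × Fin n) (Fin n × Fin n) ℂ :=
  tensorMap (channel (U : Matrix (Fin n × Fin k) (Fin n × Fin k) ℂ) Y₁)
    (channel ((U : Matrix (Fin n × Fin k) (Fin n × Fin k) ℂ).map (starRingEnd ℂ)) Y₂)
    (bellState n)

/-- The Hilbert–Schmidt (Frobenius) norm. -/
def hsNorm {ι : Type*} [Fintype ι] (A : Matrix ι ι ℂ) : ℝ :=
  Real.sqrt (∑ i, ∑ j, ‖A i j‖ ^ 2)

end

end RandomChannel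

/-! Write each projector as `y y*`. Then the channel of `U` sends `|e_i⟩⟨e_j|` to the partial trace
of `|Uξ⟩⟨Uη|` with `ξ = e_i ⊗ y`, `η = e_j ⊗ y`, and the channel of the conjugate matrix gives the
conjugate of such an expression. As `k → ∞` these partial traces concentrate, in mean square, at
`⟨ξ, η⟩ I / n`, where `⟨ξ, η⟩` is `1` if `i = j` and `0` otherwise. So in `Z = (1/n) ∑ i j, ...`
only the `n` terms with `i = j` survive, each tending to `I/n ⊗ I/n`, and `Z` tends to `I / n²`. The
two channels are never compared: the limit of each factor suffices.

Concentration needs no Weingarten calculus, only left invariance of Haar measure under three kinds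
of unitary: permutations, sign flips and one rational reflection. The reflection bounds fourth
moments of coordinates by `O(1/N²)`, `N = nk`; permutations and flips make the cross terms in the
variance nonpositive. The variance of a sum of at most `N` terms is then `O(1/N)`
(`integral_norm_sq_partialTrace_orbit_le`).

All quantities are uniformly bounded, so mean-square limits pass through products and sums, hence to
`Tr (Z ^ p)`. Markov's inequality for the squared distance gives convergence in probability. -/

namespace RandomChannel

/-! ### Haar measure and the unitaries used for symmetry -/

section Haar

variable {ι : Type*} [Fintype ι] [DecidableEq ι]

instance : IsProbabilityMeasure (haarUnitary ι) :=
  ⟨by simpa [haarUnitary] using Measure.haarMeasure_self (G := Matrix.unitaryGroup ι ℂ) (K₀ := ⊤)⟩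

instance : (haarUnitary ι).IsMulLeftInvariant := by
  unfold haarUnitary
  infer_instance

theorem integral_haarUnitary_mul_left {E : Type*} [NormedAddCommGroup E] [NormedSpace ℝ E]
    (W : Matrix.unitaryGroup ι ℂ) (F : Matrix.unitaryGroup ι ℂ → E) :
    ∫ U, F (W * U) ∂haarUnitary ι = ∫ U, F U ∂haarUnitary ι :=
  integral_mul_left_eq_self F W

theorem _root_.Continuous.integrable_haarUnitary {E : Type*} [NormedAddCommGroup E]
    [SecondCountableTopology E]
    {F : Matrix.unitaryGroup ι ℂ → E} (hF : Continuous F) : Integrable F (haarUnitary ι) := by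
  refine hF.integrable_of_hasCompactSupport ?_
  exact HasCompactSupport.of_compactSpace F

/-- The vector `U ξ`, as a function of the unitary matrix `U`. -/
def orbit (ξ : ι → ℂ) (U : Matrix.unitaryGroup ι ℂ) : ι → ℂ :=
  (U : Matrix ι ι ℂ) *ᵥ ξ

@[fun_prop]
theorem continuous_orbit_apply (ξ : ι → ℂ) (x : ι) : Continuous fun U => orbit ξ U x := by
  unfold orbit
  have : Continuous fun U : Matrix.unitaryGroup ι ℂ => (U : Matrix ι ι ℂ) *ᵥ ξ :=
    Continuous.matrix_mulVec continuous_subtype_val continuous_const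
  exact (continuous_apply x).comp this

theorem orbit_mul (ξ : ι → ℂ) (W U : Matrix.unitaryGroup ι ℂ) :
    orbit ξ (W * U) = (W : Matrix ι ι ℂ) *ᵥ orbit ξ U := by
  simp [orbit, Matrix.mulVec_mulVec]

theorem orbit_dotProduct_star (ξ η : ι → ℂ) (U : Matrix.unitaryGroup ι ℂ) :
    orbit ξ U ⬝ᵥ star (orbit η U) = ξ ⬝ᵥ star η := by
  have hU : (U : Matrix ι ι ℂ)ᴴ * (U : Matrix ι ι ℂ) = 1 :=
    Matrix.mem_unitaryGroup_iff'.mp U.2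
  rw [orbit, orbit, Matrix.star_mulVec, dotProduct_comm, Matrix.dotProduct_mulVec,
    Matrix.vecMul_vecMul, hU, Matrix.vecMul_one, dotProduct_comm]

theorem exists_unitary_perm (σ : Equiv.Perm ι) : ∃ W : Matrix.unitaryGroup ι ℂ,
    ∀ ξ U z, orbit ξ (W * U) z = orbit ξ U (σ z) := by
  refine ⟨⟨σ.permMatrix ℂ, ?_⟩, fun ξ U z => ?_⟩
  · rw [Matrix.mem_unitaryGroup_iff, Matrix.star_eq_conjTranspose, Matrix.conjTranspose_permMatrix,
      ← Matrix.permMatrix_mul]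
    simp
  · rw [orbit_mul]
    simp [Matrix.permMatrix_mulVec]

/-- The Householder matrix `1 - c u uᵀ` is self-adjoint, and `c (u ⬝ᵥ u) = 2` makes it an
involution. It supplies both the sign flips and the mixing of two coordinates. -/
theorem exists_unitary_reflection (u : ι → ℝ) (c : ℝ) (h : c * (u ⬝ᵥ u) = 2) :
    ∃ W : Matrix.unitaryGroup ι ℂ,
      ∀ ξ U z, orbit ξ (W * U) z = orbit ξ U z - c * (∑ y, u y * orbit ξ U y) * u z := by
  let w : ι → ℂ := fun x => u x
  have hw : star w = w := by ext x; simp [w]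
  have hww : (c : ℂ) * (w ⬝ᵥ w) = 2 := by
    have := congrArg (fun t : ℝ => (t : ℂ)) h
    simpa [dotProduct, w] using this
  refine ⟨⟨1 - (c : ℂ) • Matrix.vecMulVec w w, ?_⟩, fun ξ U z => ?_⟩
  · have hs : star (1 - (c : ℂ) • Matrix.vecMulVec w w) = 1 - (c : ℂ) • Matrix.vecMulVec w w := by
      rw [Matrix.star_eq_conjTranspose, Matrix.conjTranspose_sub, Matrix.conjTranspose_smul,
        Matrix.conjTranspose_vecMulVec, hw]
      simp
    have h2 : Matrix.vecMulVec w w * Matrix.vecMulVec w w = (w ⬝ᵥ w) • Matrix.vecMulVec w w := by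
      rw [Matrix.vecMulVec_mul_vecMulVec, Matrix.vecMulVec_smul]
    rw [Matrix.mem_unitaryGroup_iff, hs, sub_mul, mul_sub, mul_sub, one_mul, one_mul, mul_one,
      smul_mul_smul_comm, h2, smul_smul, mul_assoc, hww]
    module
  · rw [orbit_mul]
    simp only [Matrix.sub_mulVec, Matrix.one_mulVec, Matrix.smul_mulVec, Matrix.vecMulVec_mulVec,
      Pi.sub_apply, Pi.smul_apply, smul_eq_mul, dotProduct, w, MulOpposite.smul_eq_mul_unop, MulOpposite.unop_op]
    ring

theorem exists_unitary_flip (x : ι) : ∃ W : Matrix.unitaryGroup ι ℂ,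
    ∀ ξ U, orbit ξ (W * U) x = -orbit ξ U x ∧ ∀ z ≠ x, orbit ξ (W * U) z = orbit ξ U z := by
  obtain ⟨W, hW⟩ := exists_unitary_reflection (Pi.single x 1) 2 (by simp)
  refine ⟨W, fun ξ U => ⟨?_, fun z hz => ?_⟩⟩
  · rw [hW]
    simp [Pi.single_apply, apply_ite Complex.ofReal]
    ring
  · rw [hW]
    simp [Pi.single_apply, hz]

theorem exists_unitary_rotation {x y : ι} (hxy : x ≠ y) : ∃ W : Matrix.unitaryGroup ι ℂ,
    ∀ ξ U, orbit ξ (W * U) x = (3 * orbit ξ U x - 4 * orbit ξ U y) / 5 ∧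
      orbit ξ (W * U) y = -(4 * orbit ξ U x + 3 * orbit ξ U y) / 5 := by
  -- Reflecting along `(1, 2)` gives coefficients from the 3-4-5 triangle, so no square roots
  -- appear.
  obtain ⟨W, hW⟩ := exists_unitary_reflection (Pi.single x 1 + Pi.single y 2) (2 / 5)
    (by simp [hxy, hxy.symm]; norm_num)
  refine ⟨W, fun ξ U => ?_⟩
  constructor <;> rw [hW] <;>
    simp [Pi.single_apply, apply_ite Complex.ofReal, hxy, hxy.symm, add_mul, Finset.sum_add_distrib] <;> ring

end Haar

/-! ### Second and fourth moments of the coordinates -/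

section Moments

variable {ι : Type*} [Fintype ι] [DecidableEq ι]

theorem sum_norm_sq_orbit {ξ : ι → ℂ} (hξ : ξ ⬝ᵥ star ξ = 1) (U : Matrix.unitaryGroup ι ℂ) :
    ∑ x, ‖orbit ξ U x‖ ^ 2 = 1 := by
  have h := (orbit_dotProduct_star ξ ξ U).trans hξ
  simp only [dotProduct, Pi.star_apply, RCLike.star_def, Complex.mul_conj'] at h
  exact_mod_cast h

theorem card_mul_integral_norm_sq_orbit {ξ : ι → ℂ} (hξ : ξ ⬝ᵥ star ξ = 1) (x : ι) :
    (Fintype.card ι : ℝ) * ∫ U, ‖orbit ξ U x‖ ^ 2 ∂haarUnitary ι = 1 := by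
  have hsym : ∀ y, ∫ U, ‖orbit ξ U y‖ ^ 2 ∂haarUnitary ι
      = ∫ U, ‖orbit ξ U x‖ ^ 2 ∂haarUnitary ι := fun y => by
    obtain ⟨W, hW⟩ := exists_unitary_perm (Equiv.swap x y)
    rw [← integral_haarUnitary_mul_left W]
    simp [hW]
  have hsum : ∑ y, ∫ U, ‖orbit ξ U y‖ ^ 2 ∂haarUnitary ι = 1 := by
    rw [← integral_finsetSum _ fun y _ => Continuous.integrable_haarUnitary (by fun_prop)]
    simp [sum_norm_sq_orbit hξ]
  simpa [hsym] using hsum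

/-- The product of the two rotated coordinates is, up to sign, `(12 (a² - b²) - 7ab) / 25`. The
triangle inequality bounds `12 |‖a‖² - ‖b‖²|` by `s + 7‖a‖‖b‖`, with `s` the norm of the numerator;
squaring with `(s + t)² ≤ 2s² + 2t²` gives `72` and `193 = 144 + 49`. -/
theorem norm_pow_four_add_le (a b : ℂ) :
    72 * (‖a‖ ^ 4 + ‖b‖ ^ 4) - 193 * (‖a‖ ^ 2 * ‖b‖ ^ 2) ≤
      625 * (‖(3 * a - 4 * b) / 5‖ ^ 2 * ‖-(4 * a + 3 * b) / 5‖ ^ 2) := by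
  have h1 : ‖(3 * a - 4 * b) / 5‖ * ‖-(4 * a + 3 * b) / 5‖
      = ‖12 * (a ^ 2 - b ^ 2) - 7 * (a * b)‖ / 25 := by
    rw [← norm_mul, show (3 * a - 4 * b) / 5 * (-(4 * a + 3 * b) / 5)
      = -((12 * (a ^ 2 - b ^ 2) - 7 * (a * b)) / 25) by ring, norm_neg, norm_div]
    simp
  have h2 : 12 * |‖a‖ ^ 2 - ‖b‖ ^ 2| ≤
      ‖12 * (a ^ 2 - b ^ 2) - 7 * (a * b)‖ + 7 * (‖a‖ * ‖b‖) := by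
    have hp : 12 * |‖a‖ ^ 2 - ‖b‖ ^ 2| ≤ ‖12 * (a ^ 2 - b ^ 2)‖ := by
      rw [norm_mul, ← norm_pow, ← norm_pow]
      have := abs_norm_sub_norm_le (a ^ 2) (b ^ 2)
      simpa using this
    have hq : ‖7 * (a * b)‖ = 7 * (‖a‖ * ‖b‖) := by simp
    have := norm_add_le (12 * (a ^ 2 - b ^ 2) - 7 * (a * b)) (7 * (a * b))
    rw [sub_add_cancel, hq] at this
    linarith
  rw [← mul_pow ‖(3 * a - 4 * b) / 5‖, h1]
  set s := ‖12 * (a ^ 2 - b ^ 2) - 7 * (a * b)‖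
  have h3 : (12 * |‖a‖ ^ 2 - ‖b‖ ^ 2|) ^ 2 ≤ (s + 7 * (‖a‖ * ‖b‖)) ^ 2 :=
    pow_le_pow_left₀ (by positivity) h2 2
  rw [mul_pow, sq_abs] at h3
  nlinarith [sq_nonneg (s - 7 * (‖a‖ * ‖b‖))]

/-- Integrating the preceding inequality, invariance identifies the rotated mixed moment with the
original one. This leaves the factor `(625 + 193) / 72 < 12`. -/
theorem integral_norm_pow_four_orbit_le (ξ : ι → ℂ) {x y : ι} (hxy : x ≠ y) :
    ∫ U, ‖orbit ξ U x‖ ^ 4 ∂haarUnitary ι ≤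
      12 * ∫ U, ‖orbit ξ U x‖ ^ 2 * ‖orbit ξ U y‖ ^ 2 ∂haarUnitary ι := by
  obtain ⟨W, hW⟩ := exists_unitary_rotation hxy
  have h1 : ∫ U, (72 * (‖orbit ξ U x‖ ^ 4 + ‖orbit ξ U y‖ ^ 4)
        - 193 * (‖orbit ξ U x‖ ^ 2 * ‖orbit ξ U y‖ ^ 2)) ∂haarUnitary ι ≤
      ∫ U, 625 * (‖orbit ξ (W * U) x‖ ^ 2 * ‖orbit ξ (W * U) y‖ ^ 2) ∂haarUnitary ι := by
    refine integral_mono (Continuous.integrable_haarUnitary (by fun_prop))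
      (Continuous.integrable_haarUnitary (by fun_prop)) fun U => ?_
    simp only [(hW ξ U).1, (hW ξ U).2]
    exact norm_pow_four_add_le _ _
  rw [integral_haarUnitary_mul_left W
      fun U => 625 * (‖orbit ξ U x‖ ^ 2 * ‖orbit ξ U y‖ ^ 2),
    integral_sub (Continuous.integrable_haarUnitary (by fun_prop))
      (Continuous.integrable_haarUnitary (by fun_prop)),
    integral_const_mul, integral_const_mul, integral_const_mul,
    integral_add (Continuous.integrable_haarUnitary (by fun_prop))
      (Continuous.integrable_haarUnitary (by fun_prop))] at h1
  have h2 : 0 ≤ ∫ U, ‖orbit ξ U y‖ ^ 4 ∂haarUnitary ι := integral_nonneg fun U => by positivity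
  have h3 : 0 ≤ ∫ U, ‖orbit ξ U x‖ ^ 2 * ‖orbit ξ U y‖ ^ 2 ∂haarUnitary ι :=
    integral_nonneg fun U => by positivity
  linarith

/-- An upper bound for the fourth moments of a coordinate of a uniform random unit vector. -/
theorem card_mul_integral_norm_pow_four_orbit_le {ξ : ι → ℂ} (hξ : ξ ⬝ᵥ star ξ = 1) (x : ι) :
    (Fintype.card ι : ℝ) * ((Fintype.card ι : ℝ) - 1) * ∫ U, ‖orbit ξ U x‖ ^ 4 ∂haarUnitary ι
      ≤ 12 := by
  have hcard : ((Finset.univ.erase x).card : ℝ) = (Fintype.card ι : ℝ) - 1 := by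
    rw [Finset.card_erase_of_mem (Finset.mem_univ x), Finset.card_univ,
      Nat.cast_sub (Fintype.card_pos_iff.mpr ⟨x⟩)]
    simp
  -- Sum the mixed-moment bound over `y ≠ x`; the squared norms of these coordinates add up to at
  -- most `1`.
  have h1 : ((Fintype.card ι : ℝ) - 1) * ∫ U, ‖orbit ξ U x‖ ^ 4 ∂haarUnitary ι ≤
      12 * ∫ U, ‖orbit ξ U x‖ ^ 2 ∂haarUnitary ι := by
    calc ((Fintype.card ι : ℝ) - 1) * ∫ U, ‖orbit ξ U x‖ ^ 4 ∂haarUnitary ι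
        = ∑ y ∈ Finset.univ.erase x, ∫ U, ‖orbit ξ U x‖ ^ 4 ∂haarUnitary ι := by
          rw [Finset.sum_const, nsmul_eq_mul, hcard]
      _ ≤ ∑ y ∈ Finset.univ.erase x,
            12 * ∫ U, ‖orbit ξ U x‖ ^ 2 * ‖orbit ξ U y‖ ^ 2 ∂haarUnitary ι :=
          Finset.sum_le_sum fun y hy =>
            integral_norm_pow_four_orbit_le ξ (Finset.ne_of_mem_erase hy).symm
      _ = 12 * ∫ U, ∑ y ∈ Finset.univ.erase x,
            ‖orbit ξ U x‖ ^ 2 * ‖orbit ξ U y‖ ^ 2 ∂haarUnitary ι := by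
          rw [← Finset.mul_sum,
            integral_finsetSum _ fun y _ => Continuous.integrable_haarUnitary (by fun_prop)]
      _ ≤ 12 * ∫ U, ‖orbit ξ U x‖ ^ 2 ∂haarUnitary ι := by
          refine mul_le_mul_of_nonneg_left ?_ (by norm_num)
          refine integral_mono (Continuous.integrable_haarUnitary (by fun_prop))
            (Continuous.integrable_haarUnitary (by fun_prop)) fun U => ?_
          simp only [← Finset.mul_sum]
          refine mul_le_of_le_one_right (by positivity) ?_
          rw [← sum_norm_sq_orbit hξ U]
          exact Finset.sum_le_sum_of_subset_of_nonneg (Finset.erase_subset _ _)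
            fun _ _ _ => by positivity
  have h2 := card_mul_integral_norm_sq_orbit hξ x
  rw [mul_assoc]
  calc _ ≤ (Fintype.card ι : ℝ) * (12 * ∫ U, ‖orbit ξ U x‖ ^ 2 ∂haarUnitary ι) :=
        mul_le_mul_of_nonneg_left h1 (by positivity)
    _ = 12 := by linear_combination 12 * h2

theorem card_mul_integral_norm_sq_mul_orbit_le {ξ η : ι → ℂ} (hξ : ξ ⬝ᵥ star ξ = 1)
    (hη : η ⬝ᵥ star η = 1) (x y : ι) :
    (Fintype.card ι : ℝ) * ((Fintype.card ι : ℝ) - 1) *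
      ∫ U, ‖orbit ξ U x * star (orbit η U y)‖ ^ 2 ∂haarUnitary ι ≤ 12 := by
  have h1 : ∫ U, ‖orbit ξ U x * star (orbit η U y)‖ ^ 2 ∂haarUnitary ι ≤
      ∫ U, (1 / 2) * (‖orbit ξ U x‖ ^ 4 + ‖orbit η U y‖ ^ 4) ∂haarUnitary ι := by
    refine integral_mono (Continuous.integrable_haarUnitary (by fun_prop))
      (Continuous.integrable_haarUnitary (by fun_prop)) fun U => ?_
    simp only [norm_mul, norm_star]
    nlinarith [sq_nonneg (‖orbit ξ U x‖ ^ 2 - ‖orbit η U y‖ ^ 2)]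
  rw [integral_const_mul, integral_add (Continuous.integrable_haarUnitary (by fun_prop))
      (Continuous.integrable_haarUnitary (by fun_prop))] at h1
  have h2 := card_mul_integral_norm_pow_four_orbit_le hξ x
  have h3 := card_mul_integral_norm_pow_four_orbit_le hη y
  have h4 : (0 : ℝ) ≤ (Fintype.card ι : ℝ) * ((Fintype.card ι : ℝ) - 1) := by
    have : (1 : ℝ) ≤ Fintype.card ι := by exact_mod_cast Fintype.card_pos_iff.mpr ⟨x⟩
    nlinarith
  nlinarith [mul_le_mul_of_nonneg_left h1 h4]

end Moments

/-! ### Variance bounds from symmetry -/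

section Correlations

variable {ι : Type*} [Fintype ι] [DecidableEq ι]

theorem integral_norm_sq_sum_le_of_inner_nonpos {κ : Type*} (S : Finset κ)
    {f : κ → Matrix.unitaryGroup ι ℂ → ℂ} (hf : ∀ x, Continuous (f x))
    (hK : ∀ x ∈ S, ∀ y ∈ S, x ≠ y → ∫ U, inner ℝ (f x U) (f y U) ∂haarUnitary ι ≤ 0) :
    ∫ U, ‖∑ x ∈ S, f x U‖ ^ 2 ∂haarUnitary ι ≤ ∑ x ∈ S, ∫ U, ‖f x U‖ ^ 2 ∂haarUnitary ι := by
  classical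
  have h1 : ∀ U, ‖∑ x ∈ S, f x U‖ ^ 2 = ∑ x ∈ S, ∑ y ∈ S, inner ℝ (f x U) (f y U) := fun U => by
    rw [← real_inner_self_eq_norm_sq, sum_inner]
    simp_rw [inner_sum]
  simp_rw [h1]
  rw [integral_finsetSum _ fun x _ => Continuous.integrable_haarUnitary (by fun_prop)]
  refine Finset.sum_le_sum fun x hx => ?_
  rw [integral_finsetSum _ fun y _ => Continuous.integrable_haarUnitary (by fun_prop),
    ← Finset.add_sum_erase S _ hx]
  simp_rw [real_inner_self_eq_norm_sq]
  have := Finset.sum_nonpos fun y (hy : y ∈ S.erase x) =>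
    hK x hx y (Finset.mem_of_mem_erase hy) (Finset.ne_of_mem_erase hy).symm
  linarith

/-- Distinct members of an exchangeable family with sum zero are negatively correlated. -/
theorem integral_inner_nonpos_of_exchangeable {f : ι → Matrix.unitaryGroup ι ℂ → ℂ}
    (hf : ∀ x, Continuous (f x))
    (hsymm : ∀ σ : Equiv.Perm ι, ∃ W, ∀ U z, f z (W * U) = f (σ z) U)
    (hsum : ∀ U, ∑ x, f x U = 0) {x y : ι} (hxy : x ≠ y) :
    ∫ U, inner ℝ (f x U) (f y U) ∂haarUnitary ι ≤ 0 := by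
  have hconst : ∀ z ∈ Finset.univ.erase x, ∫ U, inner ℝ (f x U) (f z U) ∂haarUnitary ι =
      ∫ U, inner ℝ (f x U) (f y U) ∂haarUnitary ι := fun z hz => by
    obtain ⟨W, hW⟩ := hsymm (Equiv.swap y z)
    rw [← integral_haarUnitary_mul_left W]
    simp [hW, Equiv.swap_apply_of_ne_of_ne hxy (Finset.ne_of_mem_erase hz).symm]
  have h0 : ∑ z, ∫ U, inner ℝ (f x U) (f z U) ∂haarUnitary ι = 0 := by
    rw [← integral_finsetSum _ fun y _ => Continuous.integrable_haarUnitary (by fun_prop)]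
    simp_rw [← inner_sum, hsum, inner_zero_right, integral_zero]
  -- The nonnegative second moment of `f x` plus `N - 1` copies of the common correlation is zero.
  rw [← Finset.add_sum_erase _ _ (Finset.mem_univ x), Finset.sum_congr rfl hconst,
    Finset.sum_const, nsmul_eq_mul] at h0
  have h1 : 0 ≤ ∫ U, inner ℝ (f x U) (f x U) ∂haarUnitary ι :=
    integral_nonneg fun U => real_inner_self_nonneg
  have h2 : (0 : ℝ) < (Finset.univ.erase x).card := by
    exact_mod_cast Finset.card_pos.mpr ⟨y, by simp [hxy.symm]⟩
  by_contra! h3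
  nlinarith [mul_pos h2 h3]

theorem integral_norm_sq_sum_diag_le {ξ η : ι → ℂ} (hξ : ξ ⬝ᵥ star ξ = 1) (hη : η ⬝ᵥ star η = 1)
    (hd : ‖ξ ⬝ᵥ star η‖ ≤ 1) (S : Finset ι) :
    ((Fintype.card ι : ℝ) - 1) *
      ∫ U, ‖∑ x ∈ S, (orbit ξ U x * star (orbit η U x) - (ξ ⬝ᵥ star η) / Fintype.card ι)‖ ^ 2
        ∂haarUnitary ι ≤ 26 := by
  rcases isEmpty_or_nonempty ι with hι | hι
  · simp [Finset.eq_empty_of_isEmpty S]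
  set N : ℝ := (Fintype.card ι : ℝ)
  set d : ℂ := ξ ⬝ᵥ star η with hd'
  have hN1 : (1 : ℝ) ≤ N := Nat.one_le_cast.mpr Fintype.card_pos
  have hNC : (Fintype.card ι : ℂ) = (N : ℂ) := by simp [N]
  have hN0 : (Fintype.card ι : ℂ) ≠ 0 := by simp
  set f : ι → Matrix.unitaryGroup ι ℂ → ℂ :=
    fun x U => orbit ξ U x * star (orbit η U x) - d / Fintype.card ι
  have hf : ∀ x, Continuous (f x) := fun x => by fun_prop
  have h1 : ∫ U, ‖∑ x ∈ S, f x U‖ ^ 2 ∂haarUnitary ι ≤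
      ∑ x ∈ S, ∫ U, ‖f x U‖ ^ 2 ∂haarUnitary ι := by
    refine integral_norm_sq_sum_le_of_inner_nonpos S hf fun x _ y _ hxy =>
      integral_inner_nonpos_of_exchangeable hf (fun σ => ?_) (fun U => ?_) hxy
    · obtain ⟨W, hW⟩ := exists_unitary_perm σ
      exact ⟨W, fun U z => by simp [f, hW]⟩
    · have := orbit_dotProduct_star ξ η U
      rw [← hd'] at this
      simp only [dotProduct, Pi.star_apply] at this
      simp only [f, Finset.sum_sub_distrib, this, Finset.sum_const, Finset.card_univ, nsmul_eq_mul]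
      field_simp
      ring
  -- Here `26 = 2 * 12 + 2 * 1`: the product of coordinates and the centring term, of norm at most
  -- `1 / N`.
  have h2 : ∀ x, N * (N - 1) * ∫ U, ‖f x U‖ ^ 2 ∂haarUnitary ι ≤ 26 := fun x => by
    have h3 : ∫ U, ‖f x U‖ ^ 2 ∂haarUnitary ι ≤
        ∫ U, (2 * ‖orbit ξ U x * star (orbit η U x)‖ ^ 2 + 2 * (1 / N) ^ 2) ∂haarUnitary ι := by
      refine integral_mono (Continuous.integrable_haarUnitary (by fun_prop))
        (Continuous.integrable_haarUnitary (by fun_prop)) fun U => ?_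
      have h4 : ‖f x U‖ ≤ ‖orbit ξ U x * star (orbit η U x)‖ + 1 / N := by
        refine (norm_sub_le _ _).trans (add_le_add le_rfl ?_)
        rw [norm_div, hNC, Complex.norm_real, Real.norm_of_nonneg (by linarith)]
        gcongr
      have := pow_le_pow_left₀ (norm_nonneg _) h4 2
      simp only
      nlinarith [sq_nonneg (‖orbit ξ U x * star (orbit η U x)‖ - 1 / N)]
    rw [integral_add (Continuous.integrable_haarUnitary (by fun_prop))
      (Continuous.integrable_haarUnitary (by fun_prop)), integral_const_mul] at h3
    simp only [integral_const, probReal_univ, one_smul] at h3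
    have h5 := card_mul_integral_norm_sq_mul_orbit_le hξ hη x x
    have h6 : 0 ≤ N * (N - 1) := by nlinarith
    have h7 : N * (N - 1) * (1 / N) ^ 2 ≤ 1 := by
      rw [div_pow, one_pow, mul_one_div, div_le_one (by positivity)]
      nlinarith
    nlinarith [mul_le_mul_of_nonneg_left h3 h6]
  have h8 : N * ((N - 1) * ∫ U, ‖∑ x ∈ S, f x U‖ ^ 2 ∂haarUnitary ι) ≤ N * 26 := by
    calc N * ((N - 1) * ∫ U, ‖∑ x ∈ S, f x U‖ ^ 2 ∂haarUnitary ι)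
        ≤ N * ((N - 1) * ∑ x ∈ S, ∫ U, ‖f x U‖ ^ 2 ∂haarUnitary ι) := by
          refine mul_le_mul_of_nonneg_left (mul_le_mul_of_nonneg_left h1 ?_) ?_ <;> linarith
      _ = ∑ x ∈ S, N * (N - 1) * ∫ U, ‖f x U‖ ^ 2 ∂haarUnitary ι := by
          rw [← mul_assoc, Finset.mul_sum]
      _ ≤ ∑ x ∈ S, (26 : ℝ) := Finset.sum_le_sum fun x _ => h2 x
      _ ≤ N * 26 := by
          rw [Finset.sum_const, nsmul_eq_mul]
          gcongr
          exact Nat.cast_le.mpr (Finset.card_le_univ S)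
  exact le_of_mul_le_mul_left h8 (by linarith)

theorem integral_norm_sq_sum_offDiag_le {ξ η : ι → ℂ} (hξ : ξ ⬝ᵥ star ξ = 1)
    (hη : η ⬝ᵥ star η = 1) {κ : Type*} (S : Finset κ) {e₁ e₂ : κ → ι}
    (he₁ : Function.Injective e₁) (he : ∀ c c', e₂ c' ≠ e₁ c) :
    ((Fintype.card ι : ℝ) - 1) *
      ∫ U, ‖∑ c ∈ S, orbit ξ U (e₁ c) * star (orbit η U (e₂ c))‖ ^ 2 ∂haarUnitary ι ≤ 12 := by
  rcases isEmpty_or_nonempty ι with hι | hι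
  · have : IsEmpty κ := ⟨fun c => hι.elim (e₁ c)⟩
    simp [Finset.eq_empty_of_isEmpty S]
  set N : ℝ := (Fintype.card ι : ℝ)
  have hN1 : (1 : ℝ) ≤ N := Nat.one_le_cast.mpr Fintype.card_pos
  set g : κ → Matrix.unitaryGroup ι ℂ → ℂ :=
    fun c U => orbit ξ U (e₁ c) * star (orbit η U (e₂ c))
  have hg : ∀ c, Continuous (g c) := fun c => by fun_prop
  have h1 : ∫ U, ‖∑ c ∈ S, g c U‖ ^ 2 ∂haarUnitary ι ≤
      ∑ c ∈ S, ∫ U, ‖g c U‖ ^ 2 ∂haarUnitary ι := by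
    refine integral_norm_sq_sum_le_of_inner_nonpos S hg fun x _ y _ hxy => ?_
    -- Flipping this coordinate negates `g x` and fixes `g y`, so the cross term is odd and
    -- integrates to zero.
    obtain ⟨W, hW⟩ := exists_unitary_flip (e₁ x)
    have h2 := integral_haarUnitary_mul_left W fun U => inner ℝ (g x U) (g y U)
    have h3 : ∀ U, inner ℝ (g x (W * U)) (g y (W * U)) = -inner ℝ (g x U) (g y U) := fun U => by
      simp only [g, (hW ξ U).1, (hW η U).2 _ (he x x), (hW η U).2 _ (he x y),
        (hW ξ U).2 _ (he₁.ne hxy.symm), neg_mul, inner_neg_left]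
    simp_rw [h3, integral_neg] at h2
    linarith
  have hS : (S.card : ℝ) ≤ N := by
    have : S.card ≤ Fintype.card ι := by
      rw [← Finset.card_map ⟨e₁, he₁⟩]
      exact Finset.card_le_univ _
    exact Nat.cast_le.mpr this
  have h8 : N * ((N - 1) * ∫ U, ‖∑ c ∈ S, g c U‖ ^ 2 ∂haarUnitary ι) ≤ N * 12 := by
    calc N * ((N - 1) * ∫ U, ‖∑ c ∈ S, g c U‖ ^ 2 ∂haarUnitary ι)
        ≤ N * ((N - 1) * ∑ c ∈ S, ∫ U, ‖g c U‖ ^ 2 ∂haarUnitary ι) := by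
          refine mul_le_mul_of_nonneg_left (mul_le_mul_of_nonneg_left h1 ?_) ?_ <;> linarith
      _ = ∑ c ∈ S, N * (N - 1) * ∫ U, ‖g c U‖ ^ 2 ∂haarUnitary ι := by
          rw [← mul_assoc, Finset.mul_sum]
      _ ≤ ∑ c ∈ S, (12 : ℝ) := Finset.sum_le_sum fun c _ =>
          card_mul_integral_norm_sq_mul_orbit_le hξ hη (e₁ c) (e₂ c)
      _ ≤ N * 12 := by
          rw [Finset.sum_const, nsmul_eq_mul]
          gcongr
  exact le_of_mul_le_mul_left h8 (by linarith)

/-- Concentration of the partial trace of `|Uξ⟩⟨Uη|`. -/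
theorem integral_norm_sq_partialTrace_orbit_le {n k : ℕ} (hn : 1 ≤ n) (hk : 1 ≤ k)
    {ξ η : Fin n × Fin k → ℂ} (hξ : ξ ⬝ᵥ star ξ = 1) (hη : η ⬝ᵥ star η = 1)
    (hd : ‖ξ ⬝ᵥ star η‖ ≤ 1) (a b : Fin n) :
    ((k : ℝ) - 1) * ∫ U, ‖(∑ c, orbit ξ U (a, c) * star (orbit η U (b, c)))
        - (if a = b then (ξ ⬝ᵥ star η) / n else 0)‖ ^ 2 ∂haarUnitary (Fin n × Fin k) ≤ 26 := by
  have hcard : (Fintype.card (Fin n × Fin k) : ℝ) = n * k := by simp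
  have hle : (k : ℝ) - 1 ≤ (Fintype.card (Fin n × Fin k) : ℝ) - 1 := by
    rw [hcard]
    have : (1 : ℝ) ≤ n := by exact_mod_cast hn
    nlinarith [(Nat.cast_nonneg k : (0 : ℝ) ≤ k)]
  refine (mul_le_mul_of_nonneg_right hle (integral_nonneg fun U => by positivity)).trans ?_
  by_cases hab : a = b
  · subst hab
    have h := integral_norm_sq_sum_diag_le hξ hη hd
      (Finset.univ.map ⟨fun c : Fin k => (a, c), Prod.mk_right_injective a⟩)
    simp only [Finset.sum_map, Function.Embedding.coeFn_mk, Finset.sum_sub_distrib,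
      Finset.sum_const, Finset.card_map, Finset.card_univ, Fintype.card_fin] at h
    have h2 : k • (ξ ⬝ᵥ star η / (Fintype.card (Fin n × Fin k) : ℂ)) = ξ ⬝ᵥ star η / n := by
      have : (k : ℂ) ≠ 0 := by exact_mod_cast (by omega : k ≠ 0)
      have : (n : ℂ) ≠ 0 := by exact_mod_cast (by omega : n ≠ 0)
      simp only [Fintype.card_prod, Fintype.card_fin, Nat.cast_mul, nsmul_eq_mul]
      field_simp
    rw [h2] at h
    simpa using h
  · have h := integral_norm_sq_sum_offDiag_le hξ hη (Finset.univ : Finset (Fin k))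
      (e₁ := fun c => (a, c)) (e₂ := fun c => (b, c)) (Prod.mk_right_injective a)
      fun c c' h => hab (Prod.ext_iff.mp h).1.symm
    simp only [hab, if_false, sub_zero]
    linarith

end Correlations

/-! ### Entries of the output in terms of random vectors -/

section Output

theorem IsRankOneProjector.exists_eq_vecMulVec {k : ℕ} {Y : Matrix (Fin k) (Fin k) ℂ}
    (hY : IsRankOneProjector Y) :
    ∃ y : Fin k → ℂ, y ⬝ᵥ star y = 1 ∧ Y = Matrix.vecMulVec y (star y) := by
  obtain ⟨⟨hidem, hsa⟩, hrank⟩ := hY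
  obtain ⟨⟨w, hw⟩, hw0, hspan⟩ := finrank_eq_one_iff'.mp hrank
  have hw0' : w ≠ 0 := fun h => hw0 (Subtype.ext h)
  have hYw : Y *ᵥ w = w := by
    obtain ⟨z, rfl⟩ := hw
    simp [Matrix.mulVec_mulVec, hidem.eq]
  set s : ℝ := ∑ x, ‖w x‖ ^ 2 with hs
  have hws : w ⬝ᵥ star w = s := by
    simp [dotProduct, Complex.mul_conj', s]
  have hs0 : 0 < s := by
    obtain ⟨x, hx⟩ := Function.ne_iff.mp hw0'
    have : 0 < ‖w x‖ ^ 2 := by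
      have : 0 < ‖w x‖ := norm_pos_iff.mpr hx
      positivity
    exact this.trans_le
      (Finset.single_le_sum (f := fun x => ‖w x‖ ^ 2) (fun _ _ => by positivity) (Finset.mem_univ x))
  have hsqrt : ((Real.sqrt s : ℝ) : ℂ) * (Real.sqrt s : ℝ) = s := by
    exact_mod_cast Real.mul_self_sqrt hs0.le
  have hr0 : ((Real.sqrt s : ℝ) : ℂ) ≠ 0 := by
    exact_mod_cast (Real.sqrt_pos.mpr hs0).ne'
  have hstar : star ((Real.sqrt s : ℝ) : ℂ)⁻¹ = ((Real.sqrt s : ℝ) : ℂ)⁻¹ := by simp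
  set y : Fin k → ℂ := ((Real.sqrt s : ℝ) : ℂ)⁻¹ • w with hy
  have hyy : y ⬝ᵥ star y = 1 := by
    rw [hy, star_smul, hstar, smul_dotProduct, dotProduct_smul, hws, smul_eq_mul, smul_eq_mul,
      ← hsqrt]
    field_simp
  have hYy : Y *ᵥ y = y := by rw [hy, Matrix.mulVec_smul, hYw]
  refine ⟨y, hyy, Matrix.ext_of_mulVec_single fun j => ?_⟩
  set z : Fin k → ℂ := Pi.single j 1
  obtain ⟨c, hc⟩ := hspan ⟨Y *ᵥ z, z, rfl⟩
  have hc' : Y *ᵥ z = (c * (Real.sqrt s : ℝ)) • y := by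
    rw [hy, smul_smul, mul_assoc, mul_inv_cancel₀ hr0, mul_one]
    exact (congrArg Subtype.val hc).symm
  -- Self-adjointness and `Y y = y` identify the coefficient of `Y z` along `y` as `⟨y, z⟩`.
  have h1 : star y ⬝ᵥ (Y *ᵥ z) = star y ⬝ᵥ z := by
    have hYH : Yᴴ = Y := hsa
    rw [Matrix.dotProduct_mulVec, ← hYH, ← Matrix.star_mulVec, hYy]
  rw [hc', dotProduct_smul, dotProduct_comm, hyy, smul_eq_mul, mul_one] at h1
  rw [hc', h1, Matrix.vecMulVec_mulVec]
  simp

/-- The vector `e_i ⊗ y`. -/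
def basisTensor {n k : ℕ} (y : Fin k → ℂ) (i : Fin n) : Fin n × Fin k → ℂ :=
  fun x => if x.1 = i then y x.2 else 0

theorem basisTensor_dotProduct_star {n k : ℕ} {y : Fin k → ℂ} (hy : y ⬝ᵥ star y = 1)
    (i j : Fin n) :
    basisTensor y i ⬝ᵥ star (basisTensor y j) = if i = j then 1 else 0 := by
  have h : ∀ x : Fin n, (∑ c : Fin k, basisTensor y i (x, c) * star (basisTensor y j (x, c)))
      = if x = i then (if i = j then 1 else 0) else 0 := fun x => by
    rcases eq_or_ne x i with rfl | h1
    · rcases eq_or_ne x j with rfl | h2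
      · simpa [basisTensor, dotProduct] using hy
      · simp [basisTensor, h2]
    · simp [basisTensor, h1]
  simp only [dotProduct, Pi.star_apply, Fintype.sum_prod_type, h]
  simp

theorem channel_vecMulVec_single {n k : ℕ} (W : Matrix (Fin n × Fin k) (Fin n × Fin k) ℂ)
    (y : Fin k → ℂ) (i j a b : Fin n) :
    channel W (Matrix.vecMulVec y (star y)) (Matrix.single i j 1) a b =
      ∑ c, (W *ᵥ basisTensor y i) (a, c) * star ((W *ᵥ basisTensor y j) (b, c)) := by
  have h : Matrix.single i j (1 : ℂ) ⊗ₖ Matrix.vecMulVec y (star y) =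
      Matrix.vecMulVec (basisTensor y i) (star (basisTensor y j)) := by
    ext x z
    rw [Matrix.kroneckerMap_apply, Matrix.vecMulVec_apply, Matrix.vecMulVec_apply,
      Matrix.single_apply]
    simp only [eq_comm (a := i), eq_comm (a := j), Pi.star_apply, basisTensor]
    by_cases h1 : x.1 = i <;> by_cases h2 : z.1 = j <;> simp [h1, h2]
  simp only [channel, LinearMap.coe_mk, AddHom.coe_mk, partialTrace, Matrix.of_apply, h,
    Matrix.mul_vecMulVec, Matrix.vecMulVec_mul, Matrix.vecMulVec_apply, ← Matrix.star_mulVec,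
    Pi.star_apply]

theorem tensorMap_bellState {n : ℕ}
    (Φ Ψ : Matrix (Fin n) (Fin n) ℂ →ₗ[ℂ] Matrix (Fin n) (Fin n) ℂ) :
    tensorMap Φ Ψ (bellState n) = ∑ i, ∑ j,
      (1 / (n : ℂ)) • (Φ (Matrix.single i j 1) ⊗ₖ Ψ (Matrix.single i j 1)) := by
  have h : ∀ a b : Fin n × Fin n, bellState n a b =
      if a.2 = a.1 then (if b.2 = b.1 then 1 / (n : ℂ) else 0) else 0 := fun a b => by
    simp only [bellState, Matrix.smul_apply, Matrix.sum_apply, Matrix.kroneckerMap_apply,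
      Matrix.single_apply, smul_eq_mul, mul_ite, mul_one, mul_zero, ite_and]
    simp [eq_comm]
  simp only [tensorMap, h, Fintype.sum_prod_type, ite_smul, zero_smul]
  simp

/-- Since `e_i` is real, the conjugate of `U` maps `e_i ⊗ y₂` to the conjugate of `U (e_i ⊗ star
y₂)`. Both factors thus become partial traces for the same `U`. -/
theorem conjugateOutput_apply {n k : ℕ} (y₁ y₂ : Fin k → ℂ)
    (U : Matrix.unitaryGroup (Fin n × Fin k) ℂ) (s t : Fin n × Fin n) :
    conjugateOutput (Matrix.vecMulVec y₁ (star y₁)) (Matrix.vecMulVec y₂ (star y₂)) U s t =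
      ∑ i, ∑ j, (1 / (n : ℂ)) *
        ((∑ c, orbit (basisTensor y₁ i) U (s.1, c) * star (orbit (basisTensor y₁ j) U (t.1, c))) *
        star (∑ c, orbit (basisTensor (star y₂) i) U (s.2, c) *
          star (orbit (basisTensor (star y₂) j) U (t.2, c)))) := by
  have h : ∀ (i : Fin n) (x : Fin n × Fin k),
      ((U : Matrix (Fin n × Fin k) (Fin n × Fin k) ℂ).map (starRingEnd ℂ) *ᵥ basisTensor y₂ i) x
        = star (orbit (basisTensor (star y₂) i) U x) := fun i x => by
    simp only [orbit, Matrix.mulVec, dotProduct, star_sum, star_mul', Matrix.map_apply]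
    refine Finset.sum_congr rfl fun z _ => ?_
    by_cases hz : z.1 = i <;> simp [basisTensor, hz]
  simp only [conjugateOutput, tensorMap_bellState, Matrix.sum_apply, Matrix.smul_apply,
    Matrix.kroneckerMap_apply, channel_vecMulVec_single, h, smul_eq_mul, star_sum, star_mul']
  rfl

end Output

/-! ### Mean-square limits as the environment grows -/

section Limit

/-- Uniformly bounded continuous functions of the random unitary matrix that converge to a
constant in mean square as the size of the environment tends to infinity. -/
structure ConvergesTo {n : ℕ} (X : ∀ k : ℕ, Matrix.unitaryGroup (Fin n × Fin k) ℂ → ℂ) (c : ℂ) :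
    Prop where
  continuous : ∀ k, 1 ≤ k → Continuous (X k)
  bounded : ∃ B : ℝ, ∀ k, 1 ≤ k → ∀ U, ‖X k U‖ ≤ B
  tendsto : Tendsto (fun k => ∫ U, ‖X k U - c‖ ^ 2 ∂haarUnitary (Fin n × Fin k)) atTop (𝓝 0)

namespace ConvergesTo

variable {n : ℕ} {X X' : ∀ k : ℕ, Matrix.unitaryGroup (Fin n × Fin k) ℂ → ℂ} {c c' : ℂ}

theorem congr (h : ConvergesTo X c) (hX : ∀ k, 1 ≤ k → ∀ U, X' k U = X k U) :
    ConvergesTo X' c where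
  continuous k hk := by
    rw [funext (hX k hk)]
    exact h.continuous k hk
  bounded := by
    obtain ⟨B, hB⟩ := h.bounded
    exact ⟨B, fun k hk U => by rw [hX k hk]; exact hB k hk U⟩
  tendsto := by
    refine h.tendsto.congr' ?_
    filter_upwards [eventually_ge_atTop 1] with k hk
    simp [hX k hk]

theorem const (c : ℂ) : ConvergesTo (n := n) (fun _ _ => c) c where
  continuous _ _ := continuous_const
  bounded := ⟨‖c‖, fun _ _ _ => le_rfl⟩
  tendsto := by simp

theorem star (h : ConvergesTo X c) : ConvergesTo (fun k U => star (X k U)) (star c) where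
  continuous k hk := (h.continuous k hk).star
  bounded := by simpa using h.bounded
  tendsto := by
    refine h.tendsto.congr fun k => ?_
    simp_rw [← star_sub, norm_star]

theorem of_integral_le (hc : ∀ k, 1 ≤ k → Continuous (X k))
    (hb : ∃ B : ℝ, ∀ k, 1 ≤ k → ∀ U, ‖X k U‖ ≤ B) {g : ℕ → ℝ} (hg : Tendsto g atTop (𝓝 0))
    (h : ∀ᶠ k in atTop, ∫ U, ‖X k U - c‖ ^ 2 ∂haarUnitary (Fin n × Fin k) ≤ g k) :
    ConvergesTo X c :=
  ⟨hc, hb, tendsto_of_tendsto_of_tendsto_of_le_of_le' tendsto_const_nhds hg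
    (.of_forall fun _ => integral_nonneg fun _ => by positivity) h⟩

theorem add (h : ConvergesTo X c) (h' : ConvergesTo X' c') :
    ConvergesTo (fun k U => X k U + X' k U) (c + c') := by
  obtain ⟨B, hB⟩ := h.bounded
  obtain ⟨B', hB'⟩ := h'.bounded
  refine of_integral_le (fun k hk => (h.continuous k hk).add (h'.continuous k hk))
    ⟨B + B', fun k hk U => norm_add_le_of_le (hB k hk U) (hB' k hk U)⟩
    (g := fun k => 2 * (∫ U, ‖X k U - c‖ ^ 2 ∂haarUnitary (Fin n × Fin k)) +
      2 * ∫ U, ‖X' k U - c'‖ ^ 2 ∂haarUnitary (Fin n × Fin k))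
    (by simpa using (h.tendsto.const_mul 2).add (h'.tendsto.const_mul 2)) ?_
  filter_upwards [eventually_ge_atTop 1] with k hk
  have hc := h.continuous k hk
  have hc' := h'.continuous k hk
  rw [← integral_const_mul, ← integral_const_mul,
    ← integral_add (Continuous.integrable_haarUnitary (by fun_prop))
      (Continuous.integrable_haarUnitary (by fun_prop))]
  refine integral_mono (Continuous.integrable_haarUnitary (by fun_prop))
      (Continuous.integrable_haarUnitary (by fun_prop)) fun U => ?_
  have h1 : ‖X k U + X' k U - (c + c')‖ ≤ ‖X k U - c‖ + ‖X' k U - c'‖ := by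
    rw [add_sub_add_comm]
    exact norm_add_le _ _
  have := pow_le_pow_left₀ (norm_nonneg _) h1 2
  simp only
  nlinarith [sq_nonneg (‖X k U - c‖ - ‖X' k U - c'‖)]

theorem mul (h : ConvergesTo X c) (h' : ConvergesTo X' c') :
    ConvergesTo (fun k U => X k U * X' k U) (c * c') := by
  obtain ⟨B, hB⟩ := h.bounded
  obtain ⟨B', hB'⟩ := h'.bounded
  refine of_integral_le (fun k hk => (h.continuous k hk).mul (h'.continuous k hk))
    ⟨B * B', fun k hk U => norm_mul_le_of_le (hB k hk U) (hB' k hk U)⟩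
    (g := fun k => 2 * ‖c'‖ ^ 2 * (∫ U, ‖X k U - c‖ ^ 2 ∂haarUnitary (Fin n × Fin k)) +
      2 * B ^ 2 * ∫ U, ‖X' k U - c'‖ ^ 2 ∂haarUnitary (Fin n × Fin k))
    (by simpa using (h.tendsto.const_mul (2 * ‖c'‖ ^ 2)).add (h'.tendsto.const_mul (2 * B ^ 2))) ?_
  filter_upwards [eventually_ge_atTop 1] with k hk
  have hc := h.continuous k hk
  have hc' := h'.continuous k hk
  rw [← integral_const_mul, ← integral_const_mul,
    ← integral_add (Continuous.integrable_haarUnitary (by fun_prop))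
      (Continuous.integrable_haarUnitary (by fun_prop))]
  refine integral_mono (Continuous.integrable_haarUnitary (by fun_prop))
      (Continuous.integrable_haarUnitary (by fun_prop)) fun U => ?_
  -- The uniform bound `B` is what makes mean-square convergence stable under products.
  have h1 : ‖X k U * X' k U - c * c'‖ ≤ ‖X k U - c‖ * ‖c'‖ + B * ‖X' k U - c'‖ := by
    rw [show X k U * X' k U - c * c' = (X k U - c) * c' + X k U * (X' k U - c') by ring]
    refine norm_add_le_of_le (norm_mul_le _ _) (norm_mul_le_of_le (hB k hk U) le_rfl)
  have := pow_le_pow_left₀ (norm_nonneg _) h1 2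
  simp only
  nlinarith [sq_nonneg (‖X k U - c‖ * ‖c'‖ - B * ‖X' k U - c'‖)]

theorem sum {κ : Type*} (S : Finset κ)
    {X : κ → ∀ k : ℕ, Matrix.unitaryGroup (Fin n × Fin k) ℂ → ℂ} {c : κ → ℂ}
    (h : ∀ i, ConvergesTo (X i) (c i)) :
    ConvergesTo (fun k U => ∑ i ∈ S, X i k U) (∑ i ∈ S, c i) := by
  classical
  induction S using Finset.induction_on with
  | empty => simpa using const 0
  | insert i S hi ih => simpa [Finset.sum_insert hi] using (h i).add ih

theorem tendsto_integral (h : ConvergesTo X c) :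
    Tendsto (fun k => ∫ U, X k U ∂haarUnitary (Fin n × Fin k)) atTop (𝓝 c) := by
  have h1 : Tendsto (fun k => Real.sqrt (∫ U, ‖X k U - c‖ ^ 2 ∂haarUnitary (Fin n × Fin k)))
      atTop (𝓝 0) := by
    simpa using h.tendsto.sqrt
  refine tendsto_iff_norm_sub_tendsto_zero.mpr (squeeze_zero' (.of_forall fun _ => norm_nonneg _)
    ?_ h1)
  filter_upwards [eventually_ge_atTop 1] with k hk
  have hc := h.continuous k hk
  have h2 : ∫ U, X k U ∂haarUnitary (Fin n × Fin k) - c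
      = ∫ U, (X k U - c) ∂haarUnitary (Fin n × Fin k) := by
    rw [integral_sub hc.integrable_haarUnitary (integrable_const c)]
    simp
  rw [h2]
  refine (norm_integral_le_integral_norm _).trans (Real.le_sqrt_of_sq_le ?_)
  set m := ∫ U, ‖X k U - c‖ ∂haarUnitary (Fin n × Fin k)
  -- Nonnegativity of the variance of `‖X k U - c‖` gives `m²` at most its second moment.
  have h3 : 0 ≤ ∫ U, (‖X k U - c‖ ^ 2 - (2 * m) * ‖X k U - c‖ + m ^ 2)
      ∂haarUnitary (Fin n × Fin k) :=
    integral_nonneg fun U => by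
      simp only [Pi.zero_apply]
      nlinarith [sq_nonneg (‖X k U - c‖ - m)]
  rw [integral_add (Continuous.integrable_haarUnitary (by fun_prop))
      (Continuous.integrable_haarUnitary (by fun_prop)),
    integral_sub (Continuous.integrable_haarUnitary (by fun_prop))
      (Continuous.integrable_haarUnitary (by fun_prop)), integral_const_mul] at h3
  simp only [integral_const, probReal_univ, one_smul] at h3
  nlinarith

theorem matrix_pow {κ : Type*} [Fintype κ] [DecidableEq κ]
    {Z : ∀ k : ℕ, Matrix.unitaryGroup (Fin n × Fin k) ℂ → Matrix κ κ ℂ} {ρ : Matrix κ κ ℂ}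
    (h : ∀ s t, ConvergesTo (fun k U => Z k U s t) (ρ s t)) (p : ℕ) (s t : κ) :
    ConvergesTo (fun k U => (Z k U ^ p) s t) ((ρ ^ p) s t) := by
  induction p generalizing s t with
  | zero => simpa using const _
  | succ p ih =>
    simp only [pow_succ, Matrix.mul_apply]
    exact sum _ fun r => (ih s r).mul (h r t)

end ConvergesTo

theorem convergesTo_partialTrace_orbit {n : ℕ} (hn : 1 ≤ n)
    {ξ η : ∀ k, Fin n × Fin k → ℂ} {d : ℂ} (hd : ‖d‖ ≤ 1)
    (hξ : ∀ k, 1 ≤ k → ξ k ⬝ᵥ star (ξ k) = 1) (hη : ∀ k, 1 ≤ k → η k ⬝ᵥ star (η k) = 1)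
    (hξη : ∀ k, 1 ≤ k → ξ k ⬝ᵥ star (η k) = d) (a b : Fin n) :
    ConvergesTo (fun k U => ∑ c, orbit (ξ k) U (a, c) * star (orbit (η k) U (b, c)))
      (if a = b then d / n else 0) := by
  refine ConvergesTo.of_integral_le (fun k hk => by fun_prop) ⟨1, fun k hk U => ?_⟩
    (g := fun k => 26 / ((k : ℝ) - 1)) ?_ ?_
  · have hle : ∀ {ζ : Fin n × Fin k → ℂ} (_ : ζ ⬝ᵥ star ζ = 1) (a : Fin n),
        ∑ c, ‖orbit ζ U (a, c)‖ ^ 2 ≤ 1 := fun {ζ} hζ a => by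
      rw [← sum_norm_sq_orbit hζ U, Fintype.sum_prod_type]
      exact Finset.single_le_sum (f := fun a => ∑ c, ‖orbit ζ U (a, c)‖ ^ 2)
        (fun _ _ => Finset.sum_nonneg fun _ _ => by positivity) (Finset.mem_univ a)
    calc ‖∑ c, orbit (ξ k) U (a, c) * star (orbit (η k) U (b, c))‖
        ≤ ∑ c, (‖orbit (ξ k) U (a, c)‖ ^ 2 + ‖orbit (η k) U (b, c)‖ ^ 2) / 2 := by
          refine norm_sum_le_of_le _ fun c _ => ?_
          rw [norm_mul, norm_star]
          nlinarith [sq_nonneg (‖orbit (ξ k) U (a, c)‖ - ‖orbit (η k) U (b, c)‖)]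
      _ ≤ 1 := by
          rw [← Finset.sum_div, Finset.sum_add_distrib]
          linarith [hle (hξ k hk) a, hle (hη k hk) b]
  · exact tendsto_const_nhds.div_atTop
      (tendsto_atTop_add_const_right _ (-1) tendsto_natCast_atTop_atTop)
  -- The rate `26 / (k - 1)` needs `k ≥ 2` for a positive denominator.
  · filter_upwards [eventually_ge_atTop 2] with k hk
    have hk1 : 1 ≤ k := by omega
    have hk2 : (2 : ℝ) ≤ k := by exact_mod_cast hk
    have h := integral_norm_sq_partialTrace_orbit_le hn hk1 (hξ k hk1) (hη k hk1)
      (by rw [hξη k hk1]; exact hd) a b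
    rw [hξη k hk1] at h
    rw [le_div_iff₀ (by linarith), mul_comm]
    exact h

theorem convergesTo_conjugateOutput {n : ℕ} (hn : 1 ≤ n)
    {Y₁ Y₂ : ∀ k : ℕ, Matrix (Fin k) (Fin k) ℂ}
    (hY₁ : ∀ k, 1 ≤ k → IsRankOneProjector (Y₁ k)) (hY₂ : ∀ k, 1 ≤ k → IsRankOneProjector (Y₂ k))
    (s t : Fin n × Fin n) :
    ConvergesTo (fun k U => conjugateOutput (Y₁ k) (Y₂ k) U s t) (chaoticState n s t) := by
  have hdec : ∀ {Y : ∀ k : ℕ, Matrix (Fin k) (Fin k) ℂ},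
      (∀ k, 1 ≤ k → IsRankOneProjector (Y k)) → ∀ k, ∃ y : Fin k → ℂ,
        1 ≤ k → y ⬝ᵥ star y = 1 ∧ Y k = Matrix.vecMulVec y (star y) := fun hY k => by
    by_cases hk : 1 ≤ k
    · obtain ⟨y, hy⟩ := (hY k hk).exists_eq_vecMulVec
      exact ⟨y, fun _ => hy⟩
    · exact ⟨0, fun h => absurd h hk⟩
  choose y₁ hy₁ using hdec hY₁
  choose y₂ hy₂ using hdec hY₂
  have hlim : ∀ {y : ∀ k, Fin k → ℂ}, (∀ k, 1 ≤ k → y k ⬝ᵥ star (y k) = 1) →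
      ∀ i j a b : Fin n, ConvergesTo
        (fun k U => ∑ c, orbit (basisTensor (y k) i) U (a, c) *
          star (orbit (basisTensor (y k) j) U (b, c)))
        (if a = b then (if i = j then 1 else 0) / (n : ℂ) else 0) := fun {y} hy i j a b => by
    refine convergesTo_partialTrace_orbit hn (by split_ifs <;> simp)
      (fun k hk => ?_) (fun k hk => ?_) (fun k hk => basisTensor_dotProduct_star (hy k hk) i j) a b
    all_goals rw [basisTensor_dotProduct_star (hy k hk), if_pos rfl]
  have hy₂' : ∀ k, 1 ≤ k → star (y₂ k) ⬝ᵥ star (star (y₂ k)) = 1 := fun k hk => by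
    rw [star_star, dotProduct_comm]
    exact (hy₂ k hk).1
  have h := ConvergesTo.sum Finset.univ fun i : Fin n => ConvergesTo.sum Finset.univ fun j : Fin n =>
    (ConvergesTo.const (n := n) (1 / (n : ℂ))).mul
      ((hlim (fun k hk => (hy₁ k hk).1) i j s.1 t.1).mul (hlim hy₂' i j s.2 t.2).star)
  have hval : chaoticState n s t = ∑ i : Fin n, ∑ j : Fin n, (1 / (n : ℂ)) *
      ((if s.1 = t.1 then (if i = j then 1 else 0) / (n : ℂ) else 0) *
        star (if s.2 = t.2 then (if i = j then 1 else 0) / (n : ℂ) else 0)) := by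
    have hn0 : (n : ℂ) ≠ 0 := by exact_mod_cast (by omega : n ≠ 0)
    by_cases h1 : s.1 = t.1 <;> by_cases h2 : s.2 = t.2 <;>
      simp [chaoticState, Matrix.one_apply, Prod.ext_iff, h1, h2, apply_ite (starRingEnd ℂ), ite_div]
    field_simp
  rw [hval]
  refine h.congr fun k hk U => ?_
  rw [(hy₁ k hk).2, (hy₂ k hk).2, conjugateOutput_apply]

end Limit

end RandomChannel

/-! ### Moments and convergence in probability -/

theorem mainTheorem6 (n : ℕ) (hn : 1 ≤ n)
    (Y₁ Y₂ : ∀ k : ℕ, Matrix (Fin k) (Fin k) ℂ)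
    (hY₁ : ∀ k, 1 ≤ k → RandomChannel.IsRankOneProjector (Y₁ k))
    (hY₂ : ∀ k, 1 ≤ k → RandomChannel.IsRankOneProjector (Y₂ k)) :
    (∀ p : ℕ, 1 ≤ p →
      (∀ k : ℕ, 1 ≤ k →
        Integrable (fun U : Matrix.unitaryGroup (Fin n × Fin k) ℂ =>
            Matrix.trace (RandomChannel.conjugateOutput (Y₁ k) (Y₂ k) U ^ p))
          (RandomChannel.haarUnitary (Fin n × Fin k))) ∧
      Tendsto (fun k : ℕ =>
          ∫ U : Matrix.unitaryGroup (Fin n × Fin k) ℂ,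
            Matrix.trace (RandomChannel.conjugateOutput (Y₁ k) (Y₂ k) U ^ p)
              ∂(RandomChannel.haarUnitary (Fin n × Fin k)))
        atTop (𝓝 ((n : ℂ) ^ (2 - 2 * (p : ℤ))))) ∧
    (∀ ε : ℝ, 0 < ε →
      Tendsto (fun k : ℕ =>
          RandomChannel.haarUnitary (Fin n × Fin k)
            {U | ε ≤ RandomChannel.hsNorm
              (RandomChannel.conjugateOutput (Y₁ k) (Y₂ k) U - RandomChannel.chaoticState n)})
        atTop (𝓝 0)) := by
  have hZ := RandomChannel.convergesTo_conjugateOutput hn hY₁ hY₂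
  have hn0 : (n : ℂ) ≠ 0 := by exact_mod_cast (by omega : n ≠ 0)
  refine ⟨fun p _ => ?_, fun ε hε => ?_⟩
  · have h : RandomChannel.ConvergesTo
        (fun k U => Matrix.trace (RandomChannel.conjugateOutput (Y₁ k) (Y₂ k) U ^ p))
        (Matrix.trace (RandomChannel.chaoticState n ^ p)) :=
      RandomChannel.ConvergesTo.sum _ fun s => RandomChannel.ConvergesTo.matrix_pow hZ p s s
    refine ⟨fun k hk => (h.continuous k hk).integrable_haarUnitary, ?_⟩
    have hval : Matrix.trace (RandomChannel.chaoticState n ^ p) = (n : ℂ) ^ (2 - 2 * (p : ℤ)) := by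
      rw [RandomChannel.chaoticState, smul_pow, one_pow, Matrix.trace_smul, Matrix.trace_one,
        zpow_sub₀ hn0, zpow_mul]
      simp
      field_simp
    rw [← hval]
    exact h.tendsto_integral
  · have hcont : ∀ k, 1 ≤ k → ∀ s t, Continuous fun U : Matrix.unitaryGroup (Fin n × Fin k) ℂ =>
        ‖RandomChannel.conjugateOutput (Y₁ k) (Y₂ k) U s t - RandomChannel.chaoticState n s t‖ ^ 2 :=
      fun k hk s t => (((hZ s t).continuous k hk).sub continuous_const).norm.pow 2
    have hlim : Tendsto (fun k => ENNReal.ofReal ((∑ s, ∑ t, ∫ U,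
        ‖RandomChannel.conjugateOutput (Y₁ k) (Y₂ k) U s t - RandomChannel.chaoticState n s t‖ ^ 2
          ∂(RandomChannel.haarUnitary (Fin n × Fin k))) / ε ^ 2)) atTop (𝓝 0) := by
      have h := tendsto_finsetSum Finset.univ fun s _ =>
        tendsto_finsetSum Finset.univ fun t _ => (hZ s t).tendsto
      simpa using ENNReal.tendsto_ofReal (h.div_const (ε ^ 2))
    refine tendsto_of_tendsto_of_tendsto_of_le_of_le' tendsto_const_nhds hlim
      (.of_forall fun _ => zero_le) ?_
    filter_upwards [eventually_ge_atTop 1] with k hk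
    rw [← ENNReal.ofReal_toReal (measure_ne_top (RandomChannel.haarUnitary (Fin n × Fin k)) _)]
    refine ENNReal.ofReal_le_ofReal ?_
    rw [le_div_iff₀ (by positivity), mul_comm]
    have hset : {U : Matrix.unitaryGroup (Fin n × Fin k) ℂ | ε ≤ RandomChannel.hsNorm
          (RandomChannel.conjugateOutput (Y₁ k) (Y₂ k) U - RandomChannel.chaoticState n)} =
        {U | ε ^ 2 ≤ ∑ s, ∑ t, ‖RandomChannel.conjugateOutput (Y₁ k) (Y₂ k) U s t
          - RandomChannel.chaoticState n s t‖ ^ 2} := by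
      ext U
      exact Real.le_sqrt' hε
    rw [hset]
    -- Markov's inequality for the squared Hilbert–Schmidt distance, whose mean is a finite sum of
    -- entrywise mean-square errors.
    refine (mul_meas_ge_le_integral_of_nonneg (.of_forall fun U =>
      Finset.sum_nonneg fun _ _ => Finset.sum_nonneg fun _ _ => by positivity)
      (Continuous.integrable_haarUnitary (continuous_finsetSum _ fun s _ =>
        continuous_finsetSum _ fun t _ => hcont k hk s t)) _).trans_eq ?_
    rw [integral_finsetSum _ fun s _ => Continuous.integrable_haarUnitary
      (continuous_finsetSum _ fun t _ => hcont k hk s t)]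
    refine Finset.sum_congr rfl fun s _ => ?_
    rw [integral_finsetSum _ fun t _ => (hcont k hk s t).integrable_haarUnitary]
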